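/- Conventions. Let $V=\{1,\dots,n\}$. An unweighted hypergraph $H$ on $V$ is a set of hyperedges $e\subseteq V$; it is identified with its indicator vector $\chi_H\in\{0,1\}^{2^V}$, and the arity of a hyperedge is its size. For $\epsilon\in(0,1)$, a $(1\pm\epsilon)$-sparsifier of $H$ is an assignment of nonnegative weights to the hyperedges of $H$ (hyperedges outside $H$ have weight $0$) such that for every $S\subseteq V$ the total weight of the hyperedges that meet both $S$ and $V\setminus S$ lies between $(1-\epsilon)$ and $(1+\epsilon)$ times the number of hyperedges of $H$ that meet both $S$ and $V\setminus S$. A randomized linear sketch is a random matrix $A_\omega$ over a commutative ring, with columns indexed by the subsets of $V$, depending on a public random seed $\omega$; the sketch of $H$ is $A_\omega\chi_H$. Given $m$ and $r$, it takes at most $b$ bits of space if, for every seed $\omega$, the sketches $A_\omega\chi_H$ of the hypergraphs $H$ on $V$ with at most $m$ hyperedges, all of arity at most $r$, can be encoded injectively by $b$-bit strings (the seed is not counted). It recovers $(1\pm\epsilon)$-sparsifiers with failure probability $\delta$ if there is a decoder that, for each such $H$, computes from $\omega$ and $A_\omega\chi_H$ a $(1\pm\epsilon)$-sparsifier of $H$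 with probability at least $1-\delta$ over $\omega$. Theorem. For every $d>0$ there are a constant $c>0$ and an $n_0$, depending only on $d$, such that the following holds for every $\epsilon\in(0,1)$, all $n\ge n_0$, all $2\le r\le n$ and all $m\le\sum_{i=0}^{r}\binom{n}{i}$ (the number of possible hyperedges of arity at most $r$). Every randomized linear sketch that recovers a $(1\pm\epsilon)$-sparsifier, with probability at least $1-n^{-d}$, of each unweighted hypergraph on $n$ vertices with at most $m$ hyperedges, all of arity at most $r$, requires at least $$c\cdot\frac{n\,r\,\log(m/n)}{\log n}$$ bits of space. -/

import Mathlib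

open MeasureTheory

universe u v

namespace HypergraphSketch

/-- An unweighted hypergraph with the fixed vertex set `Fin n`, given by its set of hyperedges, each
of which is a set of vertices. -/
abbrev HypergraphOn (n : ℕ) := Finset (Finset (Fin n))

/-- The hypergraphs on `n` vertices that have at most `m` hyperedges, all of arity at most `r`. -/
def boundedHypergraphs (n m r : ℕ) : Set (HypergraphOn n) :=
  {H | H.card ≤ m ∧ ∀ e ∈ H, e.card ≤ r}

/-- The number of possible hyperedges of arity at most `r` on `n` vertices. -/
def numHyperedges (n r : ℕ) : ℕ :=
  (Finset.univ.filter fun e : Finset (Fin n) => e.card ≤ r).card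

/-- The hyperedge `e` crosses the cut `(S, Sᶜ)`: it has a vertex on each side. -/
def Crosses {n : ℕ} (S e : Finset (Fin n)) : Prop :=
  (∃ v ∈ e, v ∈ S) ∧ ∃ v ∈ e, v ∉ S

open Classical in
/-- The weight of the cut `(S, Sᶜ)` under the hyperedge weights `w`. -/
noncomputable def cutWeight {n : ℕ} (w : Finset (Fin n) → ℝ) (S : Finset (Fin n)) : ℝ :=
  ∑ e with Crosses S e, w e

/-- The indicator vector of a hypergraph, indexed by all sets of vertices. -/
def indicator {n : ℕ} (R : Type v) [Zero R] [One R] (H : HypergraphOn n) : Finset (Fin n) → R :=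
  fun e => if e ∈ H then 1 else 0

/-- The weights `w` form a `(1 ± ε)`-sparsifier of `H`: a nonnegatively re-weighted subhypergraph
of `H` that preserves the weight of every cut of `H` up to a factor `1 ± ε`. -/
def IsSparsifier {n : ℕ} (ε : ℝ) (H : HypergraphOn n) (w : Finset (Fin n) → ℝ) : Prop :=
  (∀ e, 0 ≤ w e) ∧ (∀ e, w e ≠ 0 → e ∈ H) ∧
    ∀ S : Finset (Fin n),
      (1 - ε) * cutWeight (indicator ℝ H) S ≤ cutWeight w S ∧
        cutWeight w S ≤ (1 + ε) * cutWeight (indicator ℝ H) S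

/-- A randomized linear sketch for hypergraphs on `n` vertices: a matrix with one column for each
set of vertices, with entries in some commutative ring (such as `ℝ`, `ℤ` or `ZMod p`), which
depends on a random (public) seed. -/
structure RandomizedLinearSketch (n : ℕ) where
  /-- the space of seeds -/
  Seed : Type u
  [measurableSpace : MeasurableSpace Seed]
  /-- the distribution of the seed -/
  law : Measure Seed
  [isProbabilityMeasure : IsProbabilityMeasure law]
  /-- the ring of scalars -/
  Scalar : Type v
  [commRing : CommRing Scalar]
  /-- the number of linear measurements -/
  numRows : ℕ
  /-- the measurement matrix -/
  matrix : Seed → Matrix (Fin numRows) (Finset (Fin n)) Scalar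

attribute [instance] RandomizedLinearSketch.measurableSpace
  RandomizedLinearSketch.isProbabilityMeasure RandomizedLinearSketch.commRing

namespace RandomizedLinearSketch

variable {n : ℕ}

/-- The sketch of the hypergraph `H` under the seed `ω`. -/
def sketch (L : RandomizedLinearSketch.{u, v} n) (ω : L.Seed) (H : HypergraphOn n) :
    Fin L.numRows → L.Scalar :=
  (L.matrix ω).mulVec (indicator L.Scalar H)

/-- From the seed and the sketch one can recover a `(1 ± ε)`-sparsifier, with failure probability
at most `δ` on each hypergraph with at most `m` hyperedges of arity at most `r`.
(For a failure event that is not measurable, `L.law` is its outer measure, so the event is then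
required to be covered by a measurable event of probability at most `δ`.) -/
def RecoversSparsifier (L : RandomizedLinearSketch.{u, v} n) (m r : ℕ) (ε δ : ℝ) : Prop :=
  ∃ decode : L.Seed → (Fin L.numRows → L.Scalar) → (Finset (Fin n) → ℝ),
    ∀ H ∈ boundedHypergraphs n m r,
      L.law {ω | ¬ IsSparsifier ε H (decode ω (L.sketch ω H))} ≤ ENNReal.ofReal δ

/-- The sketch takes at most `b` bits of space: whatever the seed, the sketches of the hypergraphs
with at most `m` hyperedges of arity at most `r` can be stored, without loss, in `b` bits.
The seed is not counted. -/
def UsesBits (L : RandomizedLinearSketch.{u, v} n) (m r b : ℕ) : Prop :=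
  ∀ ω : L.Seed, ∃ encode : (Fin L.numRows → L.Scalar) → (Fin b → Bool),
    Set.InjOn encode (L.sketch ω '' boundedHypergraphs n m r)

end RandomizedLinearSketch

end HypergraphSketch

namespace HypergraphSketch

/-! Take `N = n / 2` vertices as centers, each with `q ^ s` petals, that is, hyperedges through that
center and no other. At every center draw random petals in `K` levels that shrink geometrically. A
sparsifier of the tail hypergraph (levels at least `i`) keeps a hyperedge across the cut around each
center, so decoding the sketch of the tail names a sampled petal at every center
(`IsStarSystem.petalAt_mem`). The sketch is symmetric in the samples of the tail, so the named petal
favors none of them; most of them lie in level `i`, so usually level `i` is hit at all centers at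
once (`card_missed_level_le`).

By linearity the sketch of the tail is the total sketch minus the columns of the earlier levels. If
the total sketch is replaced by a fixed guess `y`, the petals named in round `i` depend on the
earlier levels only, so they hit level `i` at all centers with probability at most `(s i / |T|) ^
N`, where `|T| = q ^ s`. When `Q` times this is at most 1, the product over the levels of `1 + Q *
[hit]` has mean at most `2 ^ K` (`sum_prod_residual_le`). For the true total sketch this product is
at least `(1 + Q) ^ (K / 2)` with probability at least 1/4. Summing over the at most `2 ^ b` values
of the sketch gives `(1 + Q) ^ (K / 2) ≤ 4 * 2 ^ b * 2 ^ K` (`pow_le_card_of_choices`). There is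
room for `Q = 2 ^ (r * N / 16)` and for `K` of order `log (m / n) / log n`, up to a constant factor
(`exists_levels`). -/

/-! ### Averaging and counting for random samples -/

/-- Some seed does at least as well as the average one. Measurable hulls replace the failure events,
which need not be measurable. -/
theorem exists_card_le_of_measure_le {Ω ι : Type*} [MeasurableSpace Ω] [Fintype ι] (μ : Measure Ω)
    [IsProbabilityMeasure μ] (B : ι → Set Ω) {δ : ℝ} (hδ : 0 ≤ δ)
    (hB : ∀ i, μ (B i) ≤ ENNReal.ofReal δ) :
    ∃ ω, (Nat.card {i // ω ∈ B i} : ℝ) ≤ δ * Fintype.card ι := by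
  classical
  let F : Ω → ENNReal := fun ω => ∑ i, (toMeasurable μ (B i)).indicator 1 ω
  have hF : Measurable F := Finset.measurable_sum _ fun i _ =>
    measurable_one.indicator (measurableSet_toMeasurable μ (B i))
  obtain ⟨ω, hω⟩ := exists_le_lintegral (μ := μ) hF.aemeasurable
  have h1 : ∫⁻ ω, F ω ∂μ ≤ ENNReal.ofReal (δ * Fintype.card ι) := by
    rw [lintegral_finsetSum _ fun i _ =>
      measurable_one.indicator (measurableSet_toMeasurable μ (B i))]
    calc _ = ∑ i, μ (B i) := by
          refine Finset.sum_congr rfl fun i _ => ?_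
          rw [lintegral_indicator_one (measurableSet_toMeasurable μ (B i)), measure_toMeasurable]
      _ ≤ ∑ _i : ι, ENNReal.ofReal δ := Finset.sum_le_sum fun i _ => hB i
      _ = _ := by
          rw [Finset.sum_const, Finset.card_univ, nsmul_eq_mul, mul_comm, ENNReal.ofReal_mul hδ,
            ENNReal.ofReal_natCast]
  refine ⟨ω, ?_⟩
  have h2 : ((Nat.card {i // ω ∈ B i} : ℕ) : ENNReal) ≤ F ω := by
    rw [Nat.card_eq_fintype_card, Fintype.card_subtype, Finset.card_filter, Nat.cast_sum]
    refine Finset.sum_le_sum fun i _ => ?_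
    by_cases h : ω ∈ B i
    · simp [h, subset_toMeasurable μ (B i) h]
    · simp [h]
  have h3 := (h2.trans hω).trans h1
  rw [← ENNReal.ofReal_natCast, ENNReal.ofReal_le_ofReal_iff (by positivity)] at h3
  exact h3

/-- If in each round every value `z` of the residual gives the round an average weight at most `c`,
then the product of the weights, where the residual of a round is `y` minus the contributions of
the earlier rounds, has average at most `c ^ K`. -/
theorem sum_prod_residual_le {G : Type*} [AddCommGroup G] {c : ℝ} (hc : 0 ≤ c) :
    ∀ (K : ℕ) (α : Fin K → Type) [∀ i, Fintype (α i)] (φ : ∀ i, α i → G) (w : ∀ i, G → α i → ℝ)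
      (_ : ∀ i z x, 0 ≤ w i z x) (_ : ∀ i z, ∑ x, w i z x ≤ c * Fintype.card (α i)) (y : G),
      ∑ σ : (∀ i, α i), ∏ i, w i (y - ∑ j with j < i, φ j (σ j)) (σ i) ≤
        c ^ K * Fintype.card (∀ i, α i) := by
  intro K
  induction K with
  | zero => intro α _ φ w _ _ y; simp
  | succ K ih =>
    intro α _ φ w hw0 hw y
    -- Once round 0 has drawn `x`, the later rounds face the same problem with `y - φ 0 x` in place
    -- of `y`.
    have key : ∀ x : α 0, ∀ τ : (∀ i : Fin K, α i.succ),
        ∏ i, w i (y - ∑ j with j < i, φ j (Fin.cons (α := α) x τ j)) (Fin.cons (α := α) x τ i) =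
        w 0 y x * ∏ i : Fin K, w i.succ ((y - φ 0 x) - ∑ j with j < i, φ j.succ (τ j)) (τ i) := by
      intro x τ
      rw [Fin.prod_univ_succ]
      congr 1
      · simp
      · refine Finset.prod_congr rfl fun i _ => ?_
        simp only [Fin.cons_succ]
        congr 1
        rw [sub_sub, Finset.sum_filter, Fin.sum_univ_succ, Finset.sum_filter]
        simp
    rw [← (Fin.consEquiv α).sum_comp, Fintype.sum_prod_type]
    simp only [Fin.consEquiv_apply]
    simp only [key]
    simp only [← Finset.mul_sum]
    calc _ ≤ ∑ x : α 0, w 0 y x * (c ^ K * Fintype.card (∀ i : Fin K, α i.succ)) := by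
          refine Finset.sum_le_sum fun x _ => mul_le_mul_of_nonneg_left ?_ (hw0 _ _ _)
          exact ih (fun i => α i.succ) (fun i => φ i.succ) (fun i => w i.succ)
            (fun i => hw0 i.succ) (fun i => hw i.succ) _
      _ ≤ (c * Fintype.card (α 0)) * (c ^ K * Fintype.card (∀ i : Fin K, α i.succ)) := by
          rw [← Finset.sum_mul]
          exact mul_le_mul_of_nonneg_right (hw 0 y) (by positivity)
      _ = _ := by
          rw [Fintype.card_congr (Fin.consEquiv α).symm, Fintype.card_prod]
          push_cast; ring

open Classical in
-- Overwrite one hit at each center by an arbitrary value and record its position. This is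
-- reversible, because the lost entry was `g a`.
theorem card_hits_mul_le {S A T : Type*} [Fintype S] [DecidableEq S]
    [Fintype A] [DecidableEq A] [Fintype T] (g : A → T) :
    Fintype.card {x : S → A → T // ∀ a, ∃ j, x j a = g a} * Fintype.card T ^ Fintype.card A ≤
      Fintype.card S ^ Fintype.card A * Fintype.card (S → A → T) := by
  have h := Fintype.card_le_of_injective
    (fun p : {x : S → A → T // ∀ a, ∃ j, x j a = g a} × (A → T) =>
      ((fun a => (p.1.2 a).choose,
        fun j a => if j = (p.1.2 a).choose then p.2 a else p.1.1 j a) : (A → S) × (S → A → T))) ?_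
  · simpa [Fintype.card_prod, Fintype.card_fun] using h
  · rintro ⟨⟨x, hx⟩, t⟩ ⟨⟨x', hx'⟩, t'⟩ h
    simp only [Prod.mk.injEq] at h
    obtain ⟨h1, h2⟩ := h
    have e1 : ∀ a, (hx a).choose = (hx' a).choose := fun a => congrFun h1 a
    have ht : t = t' := by
      ext a
      have := congrFun (congrFun h2 (hx a).choose) a
      simpa [e1] using this
    have hxx : x = x' := by
      ext j a
      by_cases hj : j = (hx a).choose
      · have := (hx a).choose_spec
        have h' := (hx' a).choose_spec
        rw [hj, this, e1, h']
      · have := congrFun (congrFun h2 j) a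
        simpa [hj, ← e1] using this
    simp [ht, hxx]

open Classical in
theorem sum_one_add_hits_le {S A T : Type*} [Fintype S] [DecidableEq S]
    [Fintype A] [DecidableEq A] [Fintype T] [Nonempty T]
    (g : A → T) {Q : ℝ} (hQ0 : 0 ≤ Q)
    (hQ : Q * (Fintype.card S : ℝ) ^ Fintype.card A ≤ (Fintype.card T : ℝ) ^ Fintype.card A) :
    ∑ x : S → A → T, (1 + if ∀ a, ∃ j, x j a = g a then Q else 0) ≤
      2 * Fintype.card (S → A → T) := by
  rw [Finset.sum_add_distrib, ← Finset.sum_filter, Finset.sum_const, Finset.sum_const,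
    Finset.card_univ, nsmul_eq_mul, nsmul_eq_mul, ← Fintype.card_subtype]
  have h : (Fintype.card {x : S → A → T // ∀ a, ∃ j, x j a = g a} : ℝ) *
      (Fintype.card T : ℝ) ^ Fintype.card A ≤
      (Fintype.card S : ℝ) ^ Fintype.card A * Fintype.card (S → A → T) := by
    exact_mod_cast card_hits_mul_le g
  set X : ℝ := ((Fintype.card {x : S → A → T // ∀ a, ∃ j, x j a = g a} : ℕ) : ℝ)
  set Y : ℝ := ((Fintype.card (S → A → T) : ℕ) : ℝ)
  have hT : (0 : ℝ) < (Fintype.card T : ℝ) ^ Fintype.card A := by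
    have : 0 < Fintype.card T := Fintype.card_pos
    positivity
  have : X * Q ≤ Y := by
    refine le_of_mul_le_mul_right ?_ hT
    calc X * Q * _ = Q * (X * (Fintype.card T : ℝ) ^ Fintype.card A) := by ring
      _ ≤ Q * ((Fintype.card S : ℝ) ^ Fintype.card A * Y) := mul_le_mul_of_nonneg_left h hQ0
      _ = (Q * (Fintype.card S : ℝ) ^ Fintype.card A) * Y := by ring
      _ ≤ _ * Y := mul_le_mul_of_nonneg_right hQ (by positivity)
      _ = _ := by ring
  linarith

open Classical in
-- Overwriting the entry at `(j, a)` loses nothing: its old value survives at `(k, a)`.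
theorem card_eq_at_mul_le {J A T : Type*} [Fintype J] [DecidableEq J]
    [Fintype A] [DecidableEq A] [Fintype T]
    {j k : J} (hjk : j ≠ k) (a : A) :
    Fintype.card {σ : J → A → T // σ j a = σ k a} * Fintype.card T ≤ Fintype.card (J → A → T) := by
  have h := Fintype.card_le_of_injective
    (fun p : {σ : J → A → T // σ j a = σ k a} × T =>
      (Function.update p.1.1 j (Function.update (p.1.1 j) a p.2) : J → A → T)) ?_
  · simpa only [Fintype.card_prod] using h
  · rintro ⟨⟨x, hx⟩, t⟩ ⟨⟨x', hx'⟩, t'⟩ h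
    have h' : ∀ i c, Function.update x j (Function.update (x j) a t) i c =
        Function.update x' j (Function.update (x' j) a t') i c := fun i c =>
      congrFun (congrFun h i) c
    have ht : t = t' := by simpa using h' j a
    have hne : ∀ i c, (i ≠ j ∨ c ≠ a) → x i c = x' i c := by
      intro i c hic
      have := h' i c
      by_cases hi : i = j
      · subst hi
        have hc : c ≠ a := by simpa using hic
        simpa [hc] using this
      · simpa [hi] using this
    have hxx : x = x' := by
      ext i c
      by_cases hic : i ≠ j ∨ c ≠ a
      · exact hne i c hic
      · push Not at hic
        rw [hic.1, hic.2, hx, hx']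
        exact hne k a (Or.inl hjk.symm)
    simp [ht, hxx]

open Classical in
theorem card_not_injective_mul_le {J A T : Type*} [Fintype J] [DecidableEq J]
    [Fintype A] [DecidableEq A] [Fintype T] :
    (Finset.univ.filter fun σ : J → A → T => ¬ ∀ a, Function.Injective fun j => σ j a).card *
        Fintype.card T ≤
      Fintype.card A * (Fintype.card J * (Fintype.card J - 1)) * Fintype.card (J → A → T) := by
  let P : Finset (A × (J × J)) := Finset.univ ×ˢ (Finset.univ : Finset J).offDiag
  have hsub : (Finset.univ.filter fun σ : J → A → T => ¬ ∀ a, Function.Injective fun j => σ j a) ⊆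
      P.biUnion fun p => Finset.univ.filter fun σ : J → A → T => σ p.2.1 p.1 = σ p.2.2 p.1 := by
    intro σ hσ
    obtain ⟨-, h⟩ := Finset.mem_filter.1 hσ
    simp only [Function.Injective] at h
    push Not at h
    obtain ⟨a, j, k, h, hjk⟩ := h
    simp only [P, Finset.mem_biUnion, Finset.mem_product, Finset.mem_offDiag, Finset.mem_filter,
      Finset.mem_univ, true_and]
    exact ⟨(a, (j, k)), hjk, h⟩
  calc _ ≤ (∑ p ∈ P, (Finset.univ.filter
          fun σ : J → A → T => σ p.2.1 p.1 = σ p.2.2 p.1).card) * Fintype.card T :=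
        Nat.mul_le_mul_right _ ((Finset.card_le_card hsub).trans Finset.card_biUnion_le)
    _ = ∑ p ∈ P, (Finset.univ.filter
          fun σ : J → A → T => σ p.2.1 p.1 = σ p.2.2 p.1).card * Fintype.card T :=
        Finset.sum_mul _ _ _
    _ ≤ ∑ p ∈ P, Fintype.card (J → A → T) := by
        refine Finset.sum_le_sum fun p hp => ?_
        rw [← Fintype.card_subtype]
        refine card_eq_at_mul_le ?_ _
        simp only [P, Finset.mem_product, Finset.mem_offDiag, Finset.mem_univ, true_and] at hp
        exact hp
    _ = _ := by
        rw [Finset.sum_const, smul_eq_mul]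
        simp only [P, Finset.card_product, Finset.offDiag_card, Finset.card_univ]
        rw [Nat.mul_sub_one]

open Classical in
/-- Exchangeability: a value computed from the samples in `P` symmetrically falls on the samples
of `D ⊆ P` with probability at most `|D| / |P|`. -/
theorem card_symmetric_choice_mul_le {J A T : Type*} [Fintype J] [DecidableEq J]
    [Fintype A] [DecidableEq A] [Fintype T]
    (P D : Finset J) (hDP : D ⊆ P) (a : A) (h : (J → A → T) → T)
    (hh : ∀ σ, ∀ j ∈ P, ∀ k ∈ P, h (σ ∘ Equiv.swap j k) = h σ) :
    (Finset.univ.filter fun σ : J → A → T =>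
        (∀ a, Function.Injective fun j => σ j a) ∧ ∃ j ∈ D, σ j a = h σ).card * P.card ≤
      D.card * Fintype.card (J → A → T) := by
  let F : J → Finset (J → A → T) := fun j => Finset.univ.filter fun σ : J → A → T =>
    (∀ a, Function.Injective fun j => σ j a) ∧ σ j a = h σ
  -- Swapping two samples of `P` leaves `h` unchanged, so all `F j` with `j ∈ P` have the same size.
  -- They are disjoint because the samples at `a` are distinct.
  have hswap : ∀ j ∈ P, ∀ k ∈ P, (F j).card ≤ (F k).card := by
    intro j hj k hk
    refine Finset.card_le_card_of_injOn (fun σ => σ ∘ Equiv.swap j k) ?_ ?_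
    · intro σ hσ
      simp only [F, Finset.coe_filter, Finset.mem_univ, true_and, Set.mem_ofPred_eq] at hσ ⊢
      refine ⟨fun a => (hσ.1 a).comp (Equiv.swap j k).injective, ?_⟩
      rw [hh σ j hj k hk, ← hσ.2]
      simp
    · intro σ _ τ _ hστ
      funext i
      have := congrFun hστ (Equiv.swap j k i)
      simpa using this
  have hdisj : ∑ j ∈ P, (F j).card ≤ Fintype.card (J → A → T) := by
    rw [← Finset.card_biUnion, ← Finset.card_univ]
    · exact Finset.card_le_card (Finset.subset_univ _)
    · intro j _ k _ hjk
      rw [Function.onFun, Finset.disjoint_left]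
      intro σ h1 h2
      simp only [F, Finset.mem_filter, Finset.mem_univ, true_and] at h1 h2
      exact hjk (h1.1 a (h1.2.trans h2.2.symm))
  have hsub : (Finset.univ.filter fun σ : J → A → T =>
      (∀ a, Function.Injective fun j => σ j a) ∧ ∃ j ∈ D, σ j a = h σ) ⊆ D.biUnion F := by
    intro σ hσ
    simp only [Finset.mem_filter, Finset.mem_univ, true_and] at hσ
    obtain ⟨h1, j, hj, h2⟩ := hσ
    simp only [F, Finset.mem_biUnion, Finset.mem_filter, Finset.mem_univ, true_and]
    exact ⟨j, hj, h1, h2⟩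
  calc _ ≤ (∑ j ∈ D, (F j).card) * P.card :=
        Nat.mul_le_mul_right _ ((Finset.card_le_card hsub).trans Finset.card_biUnion_le)
    _ = ∑ j ∈ D, (F j).card * P.card := Finset.sum_mul _ _ _
    _ ≤ ∑ j ∈ D, Fintype.card (J → A → T) := by
        refine Finset.sum_le_sum fun j hj => ?_
        calc _ = ∑ k ∈ P, (F j).card := by rw [Finset.sum_const, smul_eq_mul, mul_comm]
          _ ≤ ∑ k ∈ P, (F k).card := Finset.sum_le_sum fun k hk => hswap j (hDP hj) k hk
          _ ≤ _ := hdisj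
    _ = _ := by rw [Finset.sum_const, smul_eq_mul]

/-! ### Levels of samples and the number of total sums -/

section Levels

variable {K : ℕ} {s : Fin K → ℕ} {A T : Type} [Fintype A]

/-- A sample of the level `k` is an element of `T` for every center; there are `s k` of them. -/
abbrev Samples {K : ℕ} (s : Fin K → ℕ) (A T : Type) := (Σ k, Fin (s k)) → A → T

/-- The samples of level at least `i`. -/
def tail (s : Fin K → ℕ) (i : Fin K) : Finset (Σ k, Fin (s k)) :=
  Finset.univ.filter fun j => i ≤ j.1

/-- The samples of level beyond `i`. -/
def strictTail (s : Fin K → ℕ) (i : Fin K) : Finset (Σ k, Fin (s k)) :=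
  Finset.univ.filter fun j => i < j.1

/-- At each center the samples are pairwise distinct. -/
def Collisionless (σ : Samples s A T) : Prop :=
  ∀ a, Function.Injective fun j => σ j a

/-- The sum of the columns of the samples in `P`. -/
def columnSum {G : Type*} [AddCommGroup G] (col : A → T → G) (P : Finset (Σ k, Fin (s k)))
    (σ : Samples s A T) : G :=
  ∑ j ∈ P, ∑ a, col a (σ j a)

variable {G : Type*} [AddCommGroup G]

theorem columnSum_comp_swap (col : A → T → G) {P : Finset (Σ k, Fin (s k))}
    (σ : Samples s A T) {j k : Σ k, Fin (s k)} (hj : j ∈ P) (hk : k ∈ P) :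
    columnSum col P (σ ∘ Equiv.swap j k) = columnSum col P σ := by
  refine Finset.sum_equiv (Equiv.swap j k) (fun i => ?_) fun i _ => rfl
  by_cases h1 : i = j
  · subst h1; simp [hj, hk]
  by_cases h2 : i = k
  · subst h2; simp [hj, hk]
  rw [Equiv.swap_apply_of_ne_of_ne h1 h2]

/-- This is where linearity enters: the total and the earlier levels determine the sum over the
tail. -/
theorem columnSum_tail (col : A → T → G) (σ : Samples s A T) (i : Fin K) :
    columnSum col (tail s i) σ =
      columnSum col Finset.univ σ - ∑ k with k < i, ∑ j : Fin (s k), ∑ a, col a (σ ⟨k, j⟩ a) := by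
  rw [eq_sub_iff_add_eq]
  simp only [columnSum, tail, Finset.sum_filter]
  rw [Fintype.sum_sigma, Fintype.sum_sigma, ← Finset.sum_add_distrib]
  refine Finset.sum_congr rfl fun k _ => ?_
  by_cases h : i ≤ k
  · simp [h, not_lt.2 h]
  · simp [h, not_le.1 h]

variable [DecidableEq A] [Fintype T]

/-- The value guessed from `z` hits the level `i` at every center. -/
def HitsLevel (g : A → T) (i : Fin K) (σ : Samples s A T) : Prop :=
  ∀ a, ∃ j : Fin (s i), σ ⟨i, j⟩ a = g a

open Classical in
/-- A fixed guess `y` for the total sum hits few levels on average. -/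
theorem sum_prod_hits_le [Nonempty T] (col : A → T → G) (g : G → A → T) {Q : ℝ} (hQ0 : 0 ≤ Q)
    (hQ : ∀ i, Q * (s i : ℝ) ^ Fintype.card A ≤ (Fintype.card T : ℝ) ^ Fintype.card A) (y : G) :
    ∑ σ : Samples s A T, ∏ i, (1 + if HitsLevel
        (g (y - ∑ k with k < i, ∑ j : Fin (s k), ∑ a, col a (σ ⟨k, j⟩ a))) i σ then Q else 0) ≤
      2 ^ K * Fintype.card (Samples s A T) := by
  have h := sum_prod_residual_le (c := 2) (by norm_num) K (fun i => Fin (s i) → A → T)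
    (fun i x => ∑ j, ∑ a, col a (x j a))
    (fun i z x => 1 + if ∀ a, ∃ j, x j a = g z a then Q else 0)
    (fun i z x => by positivity)
    (fun i z => by
      convert sum_one_add_hits_le (S := Fin (s i)) (g z) hQ0 (by simpa using hQ i)) y
  rw [Fintype.card_congr (Equiv.piCurry (fun (k : Fin K) (_ : Fin (s k)) => A → T)),
    ← (Equiv.piCurry (fun (k : Fin K) (_ : Fin (s k)) => A → T)).symm.sum_comp]
  convert h using 6
  exact Iff.rfl

open Classical in
-- If a sample of the tail is named at every center but level `i` is missed, then some center names
-- a deeper sample. Exchangeability bounds this by `1 / (16 * |A|)` per center, and a union bound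
-- over the centers gives 1/16.
theorem card_missed_level_le [Nonempty A] (col : A → T → G) (g : G → A → T) (i : Fin K)
    (hpos : 0 < s i)
    (hs : 16 * Fintype.card A * (strictTail s i).card ≤ (tail s i).card) :
    16 * (Finset.univ.filter fun σ : Samples s A T => Collisionless σ ∧
        ¬ HitsLevel (g (columnSum col (tail s i) σ)) i σ).card ≤
      16 * (Finset.univ.filter fun σ : Samples s A T => Collisionless σ ∧
        ¬ ∀ a, ∃ j ∈ tail s i, σ j a = g (columnSum col (tail s i) σ) a).card +
      Fintype.card (Samples s A T) := by
  set Bad := (Finset.univ.filter fun σ : Samples s A T => Collisionless σ ∧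
        ¬ ∀ a, ∃ j ∈ tail s i, σ j a = g (columnSum col (tail s i) σ) a)
  let F : A → Finset (Samples s A T) := fun a => Finset.univ.filter fun σ =>
    (∀ a, Function.Injective fun j => σ j a) ∧
      ∃ j ∈ strictTail s i, σ j a = g (columnSum col (tail s i) σ) a
  have hsub : (Finset.univ.filter fun σ : Samples s A T => Collisionless σ ∧
        ¬ HitsLevel (g (columnSum col (tail s i) σ)) i σ) ⊆ Bad ∪ Finset.univ.biUnion F := by
    intro σ hσ
    obtain ⟨-, h1, h2⟩ := Finset.mem_filter.1 hσ
    by_cases h3 : ∀ a, ∃ j ∈ tail s i, σ j a = g (columnSum col (tail s i) σ) a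
    · refine Finset.mem_union_right _ ?_
      simp only [HitsLevel] at h2
      push Not at h2
      obtain ⟨a, ha⟩ := h2
      obtain ⟨⟨k, j⟩, hj, hja⟩ := h3 a
      refine Finset.mem_biUnion.2 ⟨a, Finset.mem_univ _, Finset.mem_filter.2
        ⟨Finset.mem_univ _, h1, ⟨k, j⟩, ?_, hja⟩⟩
      have hik : i ≤ k := (Finset.mem_filter.1 hj).2
      refine Finset.mem_filter.2 ⟨Finset.mem_univ _, lt_of_le_of_ne hik ?_⟩
      rintro rfl
      exact ha j hja
    · exact Finset.mem_union_left _ (Finset.mem_filter.2 ⟨Finset.mem_univ _, h1, h3⟩)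
  have htail : 0 < (tail s i).card :=
    Finset.card_pos.2 ⟨⟨i, ⟨0, hpos⟩⟩, Finset.mem_filter.2 ⟨Finset.mem_univ _, le_rfl⟩⟩
  have hst : strictTail s i ⊆ tail s i := fun j hj => Finset.mem_filter.2
    ⟨Finset.mem_univ _, (Finset.mem_filter.1 hj).2.le⟩
  have hF : ∀ a, 16 * Fintype.card A * (F a).card ≤ Fintype.card (Samples s A T) := by
    intro a
    have h := card_symmetric_choice_mul_le (tail s i) (strictTail s i) hst a
      (fun σ => g (columnSum col (tail s i) σ) a)
      (fun σ j hj k hk => by rw [columnSum_comp_swap col σ hj hk])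
    refine Nat.le_of_mul_le_mul_right ?_ htail
    calc _ = 16 * Fintype.card A * ((F a).card * (tail s i).card) := by ring
      _ ≤ 16 * Fintype.card A * ((strictTail s i).card * _) := Nat.mul_le_mul_left _ h
      _ = (16 * Fintype.card A * (strictTail s i).card) * _ := by ring
      _ ≤ (tail s i).card * _ := Nat.mul_le_mul_right _ hs
      _ = _ := mul_comm _ _
  have hsum : 16 * ∑ a, (F a).card ≤ Fintype.card (Samples s A T) := by
    refine Nat.le_of_mul_le_mul_left ?_ (Fintype.card_pos (α := A))
    calc _ = ∑ a, 16 * Fintype.card A * (F a).card := by rw [← Finset.mul_sum]; ring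
      _ ≤ ∑ _a : A, Fintype.card (Samples s A T) := Finset.sum_le_sum fun a _ => hF a
      _ = _ := by rw [Finset.sum_const, smul_eq_mul, Finset.card_univ]
  have := (Finset.card_le_card hsub).trans ((Finset.card_union_le _ _).trans
    (Nat.add_le_add_left Finset.card_biUnion_le _))
  omega

open Classical in
/-- If for most samples the values `g` of the tail sums name samples of the tails, then the total
sums of the samples take many values. -/
theorem pow_le_card_of_choices [Nonempty A] [Nonempty T] (hK : 0 < K) (hpos : ∀ i, 0 < s i)
    (hs : ∀ i, 16 * Fintype.card A * (strictTail s i).card ≤ (tail s i).card)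
    (hT : 16 * (Fintype.card A * ((∑ i, s i) * (∑ i, s i - 1))) ≤ Fintype.card T)
    (col : A → T → G) (g : G → A → T) (Y : Finset G)
    (hY : ∀ σ : Samples s A T, Collisionless σ → columnSum col Finset.univ σ ∈ Y)
    (hg : 16 * ∑ i, ((Finset.univ.filter fun σ : Samples s A T => Collisionless σ ∧
        ¬ ∀ a, ∃ j ∈ tail s i, σ j a = g (columnSum col (tail s i) σ) a).card : ℝ) ≤
      K * Fintype.card (Samples s A T))
    {Q : ℝ} (hQ0 : 0 ≤ Q)
    (hQ : ∀ i, Q * (s i : ℝ) ^ Fintype.card A ≤ (Fintype.card T : ℝ) ^ Fintype.card A) :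
    (1 + Q) ^ ((K : ℝ) / 2) ≤ 4 * (Y.card * 2 ^ K) := by
  set C : Finset (Samples s A T) := Finset.univ.filter fun σ => Collisionless σ
  let hit : Fin K → Samples s A T → Prop := fun i σ => HitsLevel (g (columnSum col (tail s i) σ)) i σ
  have hTpos : 0 < Fintype.card T := Fintype.card_pos
  have hΩ : (0 : ℝ) < Fintype.card (Samples s A T) := by exact_mod_cast Fintype.card_pos
  have hcoll : 16 * (Finset.univ.filter fun σ : Samples s A T => ¬ Collisionless σ).card ≤
      Fintype.card (Samples s A T) := by
    have h : (Finset.univ.filter fun σ : Samples s A T => ¬ Collisionless σ).card * Fintype.card T ≤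
        Fintype.card A * ((∑ i, s i) * (∑ i, s i - 1)) * Fintype.card (Samples s A T) := by
      have hJ : ∑ i, s i = Fintype.card (Σ k, Fin (s k)) := by simp
      rw [hJ]
      convert card_not_injective_mul_le (J := Σ k, Fin (s k)) (A := A) (T := T)
      rfl
    refine Nat.le_of_mul_le_mul_right ?_ hTpos
    calc _ = 16 * ((Finset.univ.filter fun σ : Samples s A T => ¬ Collisionless σ).card *
          Fintype.card T) := by
          ring
      _ ≤ 16 * (Fintype.card A * ((∑ i, s i) * (∑ i, s i - 1)) *
          Fintype.card (Samples s A T)) := Nat.mul_le_mul_left _ h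
      _ = (16 * (Fintype.card A * ((∑ i, s i) * (∑ i, s i - 1)))) *
          Fintype.card (Samples s A T) := by ring
      _ ≤ Fintype.card T * _ := Nat.mul_le_mul_right _ hT
      _ = _ := mul_comm _ _
  have hCcard : C.card + (Finset.univ.filter fun σ : Samples s A T => ¬ Collisionless σ).card =
      Fintype.card (Samples s A T) := by
    rw [Finset.card_filter_add_card_filter_not, Finset.card_univ]
  -- Collisions and deeper samples cost 1/16 each, leaving 14/16. It is written as 13/16 + 1/16 so
  -- that the average decoding failure, also at most 1/16, cancels on summation.
  have hlevel : ∀ i, (13 : ℝ) / 16 * Fintype.card (Samples s A T) +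
      Fintype.card (Samples s A T) / 16 ≤
      (C.filter (hit i)).card + ((Finset.univ.filter fun σ : Samples s A T => Collisionless σ ∧
        ¬ ∀ a, ∃ j ∈ tail s i, σ j a = g (columnSum col (tail s i) σ) a).card : ℝ) := by
    intro i
    have h1 := card_missed_level_le col g i (hpos i) (hs i)
    have h2 : (C.filter (hit i)).card + (C.filter fun σ => ¬ hit i σ).card = C.card :=
      Finset.card_filter_add_card_filter_not _
    have h3 : (C.filter fun σ => ¬ hit i σ) = Finset.univ.filter fun σ : Samples s A T => Collisionless σ ∧
        ¬ HitsLevel (g (columnSum col (tail s i) σ)) i σ := Finset.filter_filter _ _ _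
    rw [h3] at h2
    have h4 : 14 * Fintype.card (Samples s A T) ≤ 16 * (C.filter (hit i)).card +
      16 * (Finset.univ.filter fun σ : Samples s A T => Collisionless σ ∧
        ¬ ∀ a, ∃ j ∈ tail s i, σ j a = g (columnSum col (tail s i) σ) a).card := by
      omega
    have h5 : (14 : ℝ) * Fintype.card (Samples s A T) ≤ 16 * (C.filter (hit i)).card +
      16 * (Finset.univ.filter fun σ : Samples s A T => Collisionless σ ∧
        ¬ ∀ a, ∃ j ∈ tail s i, σ j a = g (columnSum col (tail s i) σ) a).card := by
      exact_mod_cast h4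
    linarith
  have hhits : (13 : ℝ) / 16 * K * Fintype.card (Samples s A T) ≤
      ∑ i, ((C.filter (hit i)).card : ℝ) := by
    have := Finset.sum_le_sum fun i (_ : i ∈ Finset.univ) => hlevel i
    simp only [Finset.sum_add_distrib, Finset.sum_const, Finset.card_univ, Fintype.card_fin,
      nsmul_eq_mul] at this
    linarith
  let cnt : Samples s A T → ℕ := fun σ => (Finset.univ.filter fun i => hit i σ).card
  have hcnt : ∑ i, (C.filter (hit i)).card = ∑ σ ∈ C, cnt σ := by
    simp only [cnt, Finset.card_filter]
    exact Finset.sum_comm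
  have hcntK : ∀ σ, cnt σ ≤ K := fun σ => by
    simpa using Finset.card_le_univ (Finset.univ.filter fun i => hit i σ)
  let W := C.filter fun σ => (K : ℝ) / 2 ≤ cnt σ
  -- Samples outside `W` hit fewer than `K / 2` levels, so a mean of `13 * K / 16` forces `W` to
  -- have density at least 5/16.
  have hW : (Fintype.card (Samples s A T) : ℝ) ≤ 4 * W.card := by
    have h1 : (∑ σ ∈ C, (cnt σ : ℝ)) ≤ ∑ σ ∈ C, ((if (K : ℝ) / 2 ≤ cnt σ then (K : ℝ) else 0) +
        K / 2) := by
      refine Finset.sum_le_sum fun σ _ => ?_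
      split_ifs with h
      · have : (cnt σ : ℝ) ≤ K := by exact_mod_cast hcntK σ
        have : (0 : ℝ) ≤ K := by positivity
        linarith
      · linarith
    rw [Finset.sum_add_distrib, ← Finset.sum_filter, Finset.sum_const, Finset.sum_const,
      nsmul_eq_mul, nsmul_eq_mul] at h1
    have h2 : (C.card : ℝ) ≤ Fintype.card (Samples s A T) := by exact_mod_cast Finset.card_le_univ C
    have h3 : (∑ σ ∈ C, (cnt σ : ℝ)) = ∑ i, ((C.filter (hit i)).card : ℝ) := by
      exact_mod_cast hcnt.symm
    have hK' : (0 : ℝ) < K := by exact_mod_cast hK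
    have h4 : (13 : ℝ) / 16 * K * Fintype.card (Samples s A T) ≤
        W.card * K + Fintype.card (Samples s A T) * (K / 2) := by
      have : (C.card : ℝ) * (K / 2) ≤ Fintype.card (Samples s A T) * (K / 2) := by gcongr
      rw [h3] at h1
      exact (hhits.trans h1).trans (by gcongr)
    have h5 : K * ((Fintype.card (Samples s A T) : ℝ)) ≤ K * (4 * W.card) := by nlinarith
    exact le_of_mul_le_mul_left h5 hK'
  let Z : G → Samples s A T → ℝ := fun y σ => ∏ i, (1 + if HitsLevel
        (g (y - ∑ k with k < i, ∑ j : Fin (s k), ∑ a, col a (σ ⟨k, j⟩ a))) i σ then Q else 0)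
  have hZ0 : ∀ y σ, 0 ≤ Z y σ := fun y σ => Finset.prod_nonneg fun i _ => by positivity
  have hZ : ∀ σ ∈ W, (1 + Q) ^ ((K : ℝ) / 2) ≤ ∑ y ∈ Y, Z y σ := by
    intro σ hσ
    obtain ⟨hσC, hσK⟩ := Finset.mem_filter.1 hσ
    have hmem := hY σ (Finset.mem_filter.1 hσC).2
    -- The true total is one of the guesses in `Y`, and its term alone suffices.
    refine le_trans ?_ (Finset.single_le_sum (fun y _ => hZ0 y σ) hmem)
    have : Z (columnSum col Finset.univ σ) σ = (1 + Q) ^ (cnt σ) := by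
      simp only [Z, ← columnSum_tail]
      have : ∀ i, (1 + if HitsLevel (g (columnSum col (tail s i) σ)) i σ then Q else 0) =
          if hit i σ then 1 + Q else 1 := by
        intro i
        by_cases h : HitsLevel (g (columnSum col (tail s i) σ)) i σ
        · simp [hit, h]
        · simp [hit, h]
      simp only [this]
      rw [Finset.prod_ite, Finset.prod_const, Finset.prod_const_one, mul_one]
    rw [this, ← Real.rpow_natCast]
    exact Real.rpow_le_rpow_of_exponent_le (by linarith) hσK
  have hub : ∑ σ, ∑ y ∈ Y, Z y σ ≤ Y.card * (2 ^ K * Fintype.card (Samples s A T)) := by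
    rw [Finset.sum_comm, ← nsmul_eq_mul, ← Finset.sum_const]
    exact Finset.sum_le_sum fun y _ => sum_prod_hits_le col g hQ0 hQ y
  have hlb : W.card * (1 + Q) ^ ((K : ℝ) / 2) ≤ ∑ σ, ∑ y ∈ Y, Z y σ := by
    rw [← nsmul_eq_mul, ← Finset.sum_const]
    exact (Finset.sum_le_sum hZ).trans (Finset.sum_le_sum_of_subset_of_nonneg
      (Finset.subset_univ _) fun σ _ _ => Finset.sum_nonneg fun y _ => hZ0 y σ)
  have hpow : (0 : ℝ) ≤ (1 + Q) ^ ((K : ℝ) / 2) := by positivity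
  refine le_of_mul_le_mul_right ?_ hΩ
  calc _ ≤ (1 + Q) ^ ((K : ℝ) / 2) * (4 * W.card) := mul_le_mul_of_nonneg_left hW hpow
    _ = 4 * (W.card * (1 + Q) ^ ((K : ℝ) / 2)) := by ring
    _ ≤ 4 * (Y.card * (2 ^ K * Fintype.card (Samples s A T))) := 
      mul_le_mul_of_nonneg_left (hlb.trans hub) (by norm_num)
    _ = _ := by ring

end Levels

/-! ### From sparsifiers of star hypergraphs to named petals -/

theorem IsSparsifier.exists_crosses {n : ℕ} {ε : ℝ} (hε : ε < 1) {H : HypergraphOn n}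
    {w : Finset (Fin n) → ℝ} (hw : IsSparsifier ε H w) {S e₀ : Finset (Fin n)} (he₀ : e₀ ∈ H)
    (hS : Crosses S e₀) : ∃ e ∈ H, w e ≠ 0 ∧ Crosses S e := by
  classical
  have h1 : 0 < cutWeight (indicator ℝ H) S := by
    refine Finset.sum_pos' (fun e _ => ?_) ⟨e₀, by simpa using hS, by simp [indicator, he₀]⟩
    unfold indicator
    positivity
  have h2 : cutWeight w S ≠ 0 :=
    ((mul_pos (sub_pos.2 hε) h1).trans_le (hw.2.2 S).1).ne'
  obtain ⟨e, he, hwe⟩ := Finset.exists_ne_zero_of_sum_ne_zero h2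
  exact ⟨e, hw.2.1 e hwe, hwe, by simpa using he⟩

/-- The column of the measurement matrix that belongs to the hyperedge `e`. -/
def RandomizedLinearSketch.column {n : ℕ} (L : RandomizedLinearSketch.{u, v} n) (ω : L.Seed)
    (e : Finset (Fin n)) : Fin L.numRows → L.Scalar :=
  fun i => L.matrix ω i e

theorem RandomizedLinearSketch.sketch_eq_sum {n : ℕ} (L : RandomizedLinearSketch.{u, v} n)
    (ω : L.Seed) (H : HypergraphOn n) : L.sketch ω H = ∑ e ∈ H, L.column ω e := by
  funext i
  simp [sketch, Matrix.mulVec, dotProduct, indicator, column, Finset.sum_apply]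

open Classical in
/-- A petal with positive weight at the center `a`, if there is one. -/
noncomputable def petalAt {n : ℕ} {A T : Type} [Nonempty T] (E : A × T → Finset (Fin n))
    (w : Finset (Fin n) → ℝ) (a : A) : T :=
  if h : ∃ t, w (E (a, t)) ≠ 0 then h.choose else Classical.arbitrary T

/-- The hyperedges `E (a, t)` form stars: the vertex `c a` belongs to the hyperedges of the center
`a` only, and each hyperedge has a vertex that is not a center. -/
structure IsStarSystem {n : ℕ} {A T : Type} (E : A × T → Finset (Fin n)) (c : A → Fin n) :
    Prop where
  injective : Function.Injective E
  mem_iff : ∀ a p, c a ∈ E p ↔ p.1 = a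
  exists_mem : ∀ p, ∃ v ∈ E p, ∀ a, v ≠ c a

/-- Among the hyperedges, only those of the center `a` cross the cut around `c a`. One of them is
present, so the sparsifier must give one of them positive weight. -/
theorem IsStarSystem.petalAt_mem {n : ℕ} {A T : Type} [Nonempty T] {E : A × T → Finset (Fin n)}
    {c : A → Fin n} (hE : IsStarSystem E c) {ε : ℝ} (hε : ε < 1) {X : Finset (A × T)}
    {w : Finset (Fin n) → ℝ} (hw : IsSparsifier ε (X.image E) w) {a : A}
    (ha : ∃ t, (a, t) ∈ X) : (a, petalAt E w a) ∈ X := by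
  obtain ⟨t, ht⟩ := ha
  obtain ⟨e, heH, hwe, hec⟩ := hw.exists_crosses hε (S := {c a})
    (Finset.mem_image_of_mem E ht) (by
      obtain ⟨v, hv, hva⟩ := hE.exists_mem (a, t)
      exact ⟨⟨c a, (hE.mem_iff a (a, t)).2 rfl, by simp⟩, v, hv, by simpa using hva a⟩)
  obtain ⟨⟨a', t'⟩, hX, rfl⟩ := Finset.mem_image.1 heH
  obtain ⟨⟨v, hv, hva⟩, -⟩ := hec
  rw [Finset.mem_singleton] at hva
  subst hva
  obtain rfl : a' = a := (hE.mem_iff a _).1 hv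
  have h : ∃ t, w (E (a', t)) ≠ 0 := ⟨t', hwe⟩
  have h2 : w (E (a', petalAt E w a')) ≠ 0 := by
    rw [petalAt, dif_pos h]
    exact h.choose_spec
  obtain ⟨q, hq, hqE⟩ := Finset.mem_image.1 (hw.2.1 _ h2)
  rwa [← hE.injective hqE]

/-- The petals sampled in `P`. -/
def sampledPetals {K : ℕ} {s : Fin K → ℕ} {A T : Type} [Fintype A] [DecidableEq A] [DecidableEq T]
    (P : Finset (Σ k, Fin (s k))) (σ : Samples s A T) : Finset (A × T) :=
  (P ×ˢ (Finset.univ : Finset A)).image fun q => (q.2, σ q.1 q.2)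

/-- A hypergraph is a set and forgets repetitions; without collisions there are none, so its sketch
is the sum over the samples. -/
theorem sum_sampledPetals {K : ℕ} {s : Fin K → ℕ} {A T : Type} [Fintype A] [DecidableEq A]
    [DecidableEq T] {G : Type*} [AddCommGroup G] (P : Finset (Σ k, Fin (s k))) {σ : Samples s A T}
    (hσ : Collisionless σ) (f : A × T → G) :
    ∑ p ∈ sampledPetals P σ, f p = columnSum (fun a t => f (a, t)) P σ := by
  rw [sampledPetals, Finset.sum_image, Finset.sum_product]
  · rfl
  · rintro ⟨j, a⟩ _ ⟨k, a'⟩ _ h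
    simp only [Prod.mk.injEq] at h
    obtain ⟨rfl, h⟩ := h
    rw [hσ a h]

theorem RandomizedLinearSketch.UsesBits.ncard_le {n m r b : ℕ}
    {L : RandomizedLinearSketch.{u, v} n} (hb : L.UsesBits m r b) (ω : L.Seed) :
    (L.sketch ω '' boundedHypergraphs n m r).ncard ≤ 2 ^ b := by
  obtain ⟨enc, henc⟩ := hb ω
  rw [← henc.ncard_image]
  refine (Set.ncard_le_card _).trans ?_
  simp

/-- A sketch that recovers sparsifiers finds, from the sketch of the lower levels of a random
hypergraph, a petal of the highest of them at every center, so it takes many values. -/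
theorem sketch_space_of_starSystem {n m r b : ℕ} {ε δ : ℝ} {A T : Type} [Fintype A]
    [DecidableEq A] [Fintype T] [DecidableEq T] [Nonempty A] [Nonempty T]
    (hε : ε < 1) (hδ0 : 0 ≤ δ) (hδ : δ ≤ 1 / 16) {E : A × T → Finset (Fin n)} {c : A → Fin n}
    (hE : IsStarSystem E c) (hEr : ∀ p, (E p).card ≤ r)
    (L : RandomizedLinearSketch.{u, v} n) (hL : L.RecoversSparsifier m r ε δ)
    (hb : L.UsesBits m r b)
    {K : ℕ} {s : Fin K → ℕ} (hK : 0 < K) (hpos : ∀ i, 0 < s i)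
    (hs : ∀ i, 16 * Fintype.card A * (strictTail s i).card ≤ (tail s i).card)
    (hT : 16 * (Fintype.card A * ((∑ i, s i) * (∑ i, s i - 1))) ≤ Fintype.card T)
    (hm : (∑ i, s i) * Fintype.card A ≤ m)
    {Q : ℝ} (hQ0 : 0 ≤ Q)
    (hQ : ∀ i, Q * (s i : ℝ) ^ Fintype.card A ≤ (Fintype.card T : ℝ) ^ Fintype.card A) :
    (1 + Q) ^ ((K : ℝ) / 2) ≤ 4 * (2 ^ b * 2 ^ K) := by
  classical
  obtain ⟨decode, hdec⟩ := hL
  have hbd : ∀ (P : Finset (Σ k, Fin (s k))) (σ : Samples s A T),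
      (sampledPetals P σ).image E ∈ boundedHypergraphs n m r := by
    intro P σ
    refine ⟨?_, fun e he => ?_⟩
    · refine Finset.card_image_le.trans (Finset.card_image_le.trans (le_trans ?_ hm))
      rw [Finset.card_product, Finset.card_univ]
      refine Nat.mul_le_mul_right _ ((Finset.card_le_univ P).trans ?_)
      simp
    · obtain ⟨p, -, rfl⟩ := Finset.mem_image.1 he
      exact hEr p
  -- Fix one seed for which decoding fails on at most a fraction `δ` of the pairs of a level and a
  -- sample. From here on the sketch is deterministic.
  obtain ⟨ω, hω⟩ := exists_card_le_of_measure_le L.law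
    (fun q : Fin K × Samples s A T => {ω | ¬ IsSparsifier ε
      ((sampledPetals (tail s q.1) q.2).image E)
      (decode ω (L.sketch ω ((sampledPetals (tail s q.1) q.2).image E)))}) hδ0
    (fun q => hdec _ (hbd _ _))
  let col : A → T → (Fin L.numRows → L.Scalar) := fun a t => L.column ω (E (a, t))
  have hsk : ∀ (P : Finset (Σ k, Fin (s k))) (σ : Samples s A T), Collisionless σ →
      L.sketch ω ((sampledPetals P σ).image E) = columnSum col P σ := by
    intro P σ hσ
    rw [L.sketch_eq_sum, Finset.sum_image hE.injective.injOn]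
    exact sum_sampledPetals P hσ fun p => L.column ω (E p)
  let g : (Fin L.numRows → L.Scalar) → A → T := fun z => petalAt E (decode ω z)
  have hfin : (L.sketch ω '' boundedHypergraphs n m r).Finite := Set.toFinite _
  have hg : 16 * ∑ i, ((Finset.univ.filter fun σ : Samples s A T => Collisionless σ ∧
        ¬ ∀ a, ∃ j ∈ tail s i, σ j a = g (columnSum col (tail s i) σ) a).card : ℝ) ≤
      K * Fintype.card (Samples s A T) := by
    have h1 : ∑ i, (Finset.univ.filter fun σ : Samples s A T => Collisionless σ ∧
        ¬ ∀ a, ∃ j ∈ tail s i, σ j a = g (columnSum col (tail s i) σ) a).card ≤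
        Nat.card {q : Fin K × Samples s A T // ω ∈ {ω | ¬ IsSparsifier ε
          ((sampledPetals (tail s q.1) q.2).image E)
          (decode ω (L.sketch ω ((sampledPetals (tail s q.1) q.2).image E)))}} := by
      rw [Nat.card_eq_fintype_card, Fintype.card_subtype, Finset.card_filter,
        Fintype.sum_prod_type]
      refine Finset.sum_le_sum fun i _ => ?_
      rw [← Finset.card_filter]
      refine Finset.card_le_card fun σ hσ => ?_
      obtain ⟨-, hc, h⟩ := Finset.mem_filter.1 hσ
      refine Finset.mem_filter.2 ⟨Finset.mem_univ _, fun hsp => h fun a => ?_⟩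
      have hmem := hE.petalAt_mem hε hsp (a := a) ⟨σ ⟨i, ⟨0, hpos i⟩⟩ a,
        Finset.mem_image.2 ⟨(⟨i, ⟨0, hpos i⟩⟩, a), by simp [tail], rfl⟩⟩
      rw [hsk _ _ hc] at hmem
      obtain ⟨⟨j, a'⟩, hj, hja⟩ := Finset.mem_image.1 hmem
      simp only [Prod.mk.injEq] at hja
      obtain ⟨rfl, hja⟩ := hja
      exact ⟨j, (Finset.mem_product.1 hj).1, hja⟩
    have h2 := (Nat.cast_le (α := ℝ)).2 h1
    rw [Nat.cast_sum] at h2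
    have h3 := h2.trans hω
    rw [Fintype.card_prod, Fintype.card_fin, Nat.cast_mul] at h3
    have h4 : δ * ((K : ℝ) * Fintype.card (Samples s A T)) ≤
      1 / 16 * ((K : ℝ) * Fintype.card (Samples s A T)) := by gcongr
    linarith
  have h := pow_le_card_of_choices hK hpos hs hT col g hfin.toFinset
    (fun σ hσ => hfin.mem_toFinset.2 ⟨_, hbd Finset.univ σ, hsk _ _ hσ⟩) (by convert hg) hQ0 hQ
  refine h.trans ?_
  have hcard : ((hfin.toFinset.card : ℕ) : ℝ) ≤ 2 ^ b := by
    rw [← Set.ncard_eq_toFinset_card _ hfin]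
    exact_mod_cast hb.ncard_le ω
  gcongr

/-! ### Construction of the stars and choice of parameters -/

/-- Besides the centers, reserve `s` disjoint blocks of `q` vertices. A petal consists of its center
and one vertex from each block. -/
theorem exists_starSystem {n N s q : ℕ} (hs : 0 < s) (h : N + s * q ≤ n) :
    ∃ (E : Fin N × (Fin s → Fin q) → Finset (Fin n)) (c : Fin N → Fin n),
      IsStarSystem E c ∧ ∀ p, (E p).card ≤ s + 1 := by
  classical
  obtain ⟨β⟩ := Function.Embedding.nonempty_of_card_le
    (α := Fin N ⊕ (Fin s × Fin q)) (β := Fin n) (by simpa using h)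
  let E : Fin N × (Fin s → Fin q) → Finset (Fin n) := fun p =>
    insert (β (Sum.inl p.1)) (Finset.univ.image fun k => β (Sum.inr (k, p.2 k)))
  have hinl : ∀ a p, β (Sum.inl a) ∈ E p ↔ p.1 = a := by
    intro a p
    simp [E, eq_comm]
  have hinr : ∀ k x p, β (Sum.inr (k, x)) ∈ E p ↔ p.2 k = x := by
    intro k x p
    simp only [E, Finset.mem_insert, Finset.mem_image, Finset.mem_univ, true_and,
      EmbeddingLike.apply_eq_iff_eq, reduceCtorEq, false_or, Sum.inr.injEq, Prod.mk.injEq]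
    exact ⟨fun ⟨k', h1, h2⟩ => by rw [← h1, h2], fun h => ⟨k, rfl, h⟩⟩
  refine ⟨E, fun a => β (Sum.inl a), ⟨?_, hinl, ?_⟩, ?_⟩
  · intro p p' hp
    refine Prod.ext ?_ (funext fun k => ?_)
    · exact ((hinl p.1 p').1 (hp ▸ (hinl p.1 p).2 rfl)).symm
    · exact ((hinr k (p.2 k) p').1 (hp ▸ (hinr k (p.2 k) p).2 rfl)).symm
  · intro p
    refine ⟨β (Sum.inr (⟨0, hs⟩, p.2 ⟨0, hs⟩)), (hinr _ _ _).2 rfl, fun a => ?_⟩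
    simp
  · intro p
    refine (Finset.card_insert_le _ _).trans (Nat.add_le_add_right ?_ 1)
    exact Finset.card_image_le.trans (by simp)

/-- The number of samples of the level `i`, when the levels shrink geometrically. -/
def geomLevels (p K : ℕ) : Fin K → ℕ := fun i => p ^ (K - 1 - i)

theorem sum_geomLevels (p K : ℕ) : ∑ i, geomLevels p K i = ∑ j ∈ Finset.range K, p ^ j := by
  simp only [geomLevels]
  rw [Fin.sum_univ_eq_sum_range (fun i => p ^ (K - 1 - i)) K]
  exact Finset.sum_range_reflect (fun j => p ^ j) K

theorem card_strictTail_geomLevels_le (p K : ℕ) (i : Fin K) :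
    (strictTail (geomLevels p K) i).card ≤ ∑ j ∈ Finset.range (K - 1 - i), p ^ j := by
  classical
  have h1 : (strictTail (geomLevels p K) i).card =
      ∑ k : Fin K with i < k, p ^ (K - 1 - (k : ℕ)) := by
    rw [strictTail, Finset.card_filter, Fintype.sum_sigma, Finset.sum_filter]
    refine Finset.sum_congr rfl fun k _ => ?_
    split_ifs
    · rw [Finset.sum_const, Finset.card_univ, Fintype.card_fin, smul_eq_mul, mul_one]
      rfl
    · exact Finset.sum_const_zero
  rw [h1, ← Finset.sum_image (s := Finset.univ.filter fun k : Fin K => i < k)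
    (g := fun k : Fin K => K - 1 - (k : ℕ)) (f := fun j => p ^ j)]
  · refine Finset.sum_le_sum_of_subset fun j hj => ?_
    obtain ⟨k, hk, rfl⟩ := Finset.mem_image.1 hj
    have hik : (i : ℕ) < k := (Finset.mem_filter.1 hk).2
    have := k.2
    exact Finset.mem_range.2 (by omega)
  · intro k _ k' _ hkk
    have := k.2
    have := k'.2
    simp only at hkk
    exact Fin.ext (by omega)

/-- For ratio `x + 1`, the geometric sum times `x` is one less than the next power, which is the
size of level `i`. -/
theorem mul_card_strictTail_geomLevels_le (x K : ℕ) (i : Fin K) :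
    x * (strictTail (geomLevels (x + 1) K) i).card ≤ (tail (geomLevels (x + 1) K) i).card := by
  have h1 := card_strictTail_geomLevels_le (x + 1) K i
  have h2 := geom_sum_mul_add x (K - 1 - i)
  have h3 : (x + 1) ^ (K - 1 - (i : ℕ)) ≤ (tail (geomLevels (x + 1) K) i).card := by
    have : (Finset.univ : Finset (Fin (geomLevels (x + 1) K i))).card ≤
        (tail (geomLevels (x + 1) K) i).card :=
      Finset.card_le_card_of_injOn (fun j => ⟨i, j⟩) (fun j _ => by simp [tail])
        (fun j _ j' _ h => by simpa using h)
    rwa [Finset.card_univ, Fintype.card_fin] at this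
  have h4 := Nat.mul_le_mul_left x h1
  rw [mul_comm x (∑ j ∈ _, _)] at h4
  omega

/-- Give each set `e` the weight `x ^ |e|` with `x = r / n ≤ 1`. The total weight is `(1 + x) ^ n ≤
exp r`, and each counted set has weight at least `x ^ r`. -/
theorem numHyperedges_le (n r : ℕ) (hr : 0 < r) (hrn : r ≤ n) :
    (numHyperedges n r : ℝ) ≤ (Real.exp 1 * (n / r)) ^ r := by
  have hr' : (0 : ℝ) < r := by exact_mod_cast hr
  have hn' : (0 : ℝ) < n := by exact_mod_cast hr.trans_le hrn
  set x : ℝ := r / n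
  have hx : 0 < x := by positivity
  have hx1 : x ≤ 1 := (div_le_one hn').2 (by exact_mod_cast hrn)
  have h1 : (numHyperedges n r : ℝ) * x ^ r ≤ (x + 1) ^ n := by
    have h := Fintype.sum_pow_mul_eq_add_pow (Fin n) x 1
    simp only [one_pow, mul_one, Fintype.card_fin] at h
    rw [← h, numHyperedges, ← nsmul_eq_mul, ← Finset.sum_const]
    refine (Finset.sum_le_sum fun e he => ?_).trans (Finset.sum_le_sum_of_subset_of_nonneg
      (Finset.subset_univ _) fun e _ _ => by positivity)
    exact pow_le_pow_of_le_one hx.le hx1 (Finset.mem_filter.1 he).2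
  have h2 : (x + 1) ^ n ≤ Real.exp 1 ^ r := by
    calc (x + 1) ^ n ≤ Real.exp x ^ n := by gcongr; exact Real.add_one_le_exp x
      _ = Real.exp 1 ^ r := by
        rw [← Real.exp_nat_mul, ← Real.exp_nat_mul]
        congr 1
        simp only [x]
        field_simp
  refine le_of_mul_le_mul_right ((h1.trans h2).trans_eq ?_) (pow_pos hx r)
  rw [← mul_pow]
  congr 1
  simp only [x]
  field_simp

/-- `q` vertices for each of `r / 8 + 1` coordinates give sufficiently many petals. -/
theorem petals_parameters {n r : ℕ} (hn : 16 ≤ n) (hr : 2 ≤ r) (hrn : r ≤ n) :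
    ∃ s q : ℕ, 0 < s ∧ s + 1 ≤ r ∧ r ≤ 8 * s ∧ 2 ≤ q ∧ n ≤ q * r ∧ n / 2 + s * q ≤ n := by
  refine ⟨r / 8 + 1, (n - n / 2) / (r / 8 + 1), by omega, by omega, by omega, ?_, ?_, ?_⟩
  · rw [Nat.le_div_iff_mul_le (by omega)]
    omega
  · obtain h8 | h8 := lt_or_ge r 8
    · have : r / 8 = 0 := by omega
      rw [this]
      simp only [zero_add, Nat.div_one]
      calc n ≤ (n - n / 2) * 2 := by omega
        _ ≤ _ := Nat.mul_le_mul_left _ hr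
    · have h1 := Nat.lt_mul_div_succ (n - n / 2) (show 0 < r / 8 + 1 by omega)
      have h2 : 2 ≤ (n - n / 2) / (r / 8 + 1) := by
        rw [Nat.le_div_iff_mul_le (by omega)]
        omega
      generalize (n - n / 2) / (r / 8 + 1) = q at *
      have h3 : 4 * (r / 8 + 1) ≤ r := by omega
      have h4 : n ≤ 2 * (n - n / 2) := by omega
      generalize r / 8 + 1 = s at *
      nlinarith
  · have := Nat.mul_div_le (n - n / 2) (r / 8 + 1)
    omega

/-- Since `m / n ≤ (e * n / r) ^ r ≤ q ^ (4 * r)`, each factor on the left is at most `q ^ (r /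
16)`, and `r / 8 ≤ s`. -/
theorem petals_lower_bound {n m r s q : ℕ} (hr : 2 ≤ r) (hrn : r ≤ n)
    (hm : m ≤ numHyperedges n r) (hsr : r ≤ 8 * s) (hq : 2 ≤ q) (hqn : n ≤ q * r) :
    (2 : ℝ) ^ ((r : ℝ) / 16) * ((m : ℝ) / n) ^ ((1 : ℝ) / 64) ≤ ((q ^ s : ℕ) : ℝ) := by
  have hr' : (0 : ℝ) < r := by exact_mod_cast (by omega : 0 < r)
  have hn1 : (1 : ℝ) ≤ n := by exact_mod_cast (by omega : 1 ≤ n)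
  have hq' : (2 : ℝ) ≤ q := by exact_mod_cast hq
  have hx : (m : ℝ) / n ≤ ((q : ℝ) ^ 4) ^ r := by
    calc (m : ℝ) / n ≤ m := div_le_self (by positivity) hn1
      _ ≤ numHyperedges n r := by exact_mod_cast hm
      _ ≤ (Real.exp 1 * (n / r)) ^ r := numHyperedges_le n r (by omega) hrn
      _ ≤ ((q : ℝ) ^ 4) ^ r := by
        gcongr
        have h1 : (n : ℝ) / r ≤ q := by
          rw [div_le_iff₀ hr']
          exact_mod_cast hqn
        have h2 : Real.exp 1 ≤ (q : ℝ) ^ 3 := by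
          have := Real.exp_one_lt_three
          have : (2 : ℝ) ^ 3 ≤ (q : ℝ) ^ 3 := by gcongr
          linarith
        calc _ ≤ (q : ℝ) ^ 3 * q := by gcongr
          _ = _ := by ring
  have h1 : ((m : ℝ) / n) ^ ((1 : ℝ) / 64) ≤ (q : ℝ) ^ ((r : ℝ) / 16) := by
    calc _ ≤ (((q : ℝ) ^ 4) ^ r) ^ ((1 : ℝ) / 64) := by gcongr
      _ = _ := by
        rw [← pow_mul, ← Real.rpow_natCast, ← Real.rpow_mul (by positivity)]
        congr 1
        push_cast
        ring
  have h2 : (2 : ℝ) ^ ((r : ℝ) / 16) ≤ (q : ℝ) ^ ((r : ℝ) / 16) := by gcongr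
  calc _ ≤ (q : ℝ) ^ ((r : ℝ) / 16) * (q : ℝ) ^ ((r : ℝ) / 16) := by gcongr
    _ = (q : ℝ) ^ ((r : ℝ) / 8) := by
      rw [← Real.rpow_add (by positivity)]
      congr 1
      ring
    _ ≤ (q : ℝ) ^ (s : ℝ) := by
      refine Real.rpow_le_rpow_of_exponent_le (by linarith) ?_
      rw [div_le_iff₀ (by norm_num)]
      exact_mod_cast (by omega : r ≤ s * 8)
    _ = _ := by rw [Real.rpow_natCast, Nat.cast_pow]

/-- The numerical form of the lower bound, with `K` levels and ratio `16 * (n / 2) + 1`. -/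
theorem sketch_space_of_levels {n m r b K s q : ℕ} {ε δ : ℝ} (hn : 2 ≤ n)
    (hε : ε < 1) (hδ0 : 0 ≤ δ) (hδ : δ ≤ 1 / 16)
    (L : RandomizedLinearSketch.{u, v} n) (hL : L.RecoversSparsifier m r ε δ)
    (hb : L.UsesBits m r b) (hs : 0 < s) (hsr : s + 1 ≤ r) (hq : 0 < q) (hsq : n / 2 + s * q ≤ n)
    (hK : 0 < K)
    (hT : 16 * (n / 2 * ((∑ j ∈ Finset.range K, (16 * (n / 2) + 1) ^ j) *
      (∑ j ∈ Finset.range K, (16 * (n / 2) + 1) ^ j - 1))) ≤ q ^ s)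
    (hm : (∑ j ∈ Finset.range K, (16 * (n / 2) + 1) ^ j) * (n / 2) ≤ m)
    (hU : (2 : ℝ) ^ ((r : ℝ) / 16) * ((16 * (n / 2) + 1 : ℕ) : ℝ) ^ (K - 1) ≤ ((q ^ s : ℕ) : ℝ)) :
    (r : ℝ) * (n / 2 : ℕ) * K / 32 ≤ b + 2 + K := by
  obtain ⟨E, c, hE, hEs⟩ := exists_starSystem (N := n / 2) hs hsq
  set N := n / 2
  set p := 16 * N + 1
  have hN : 0 < N := by omega
  have : Nonempty (Fin N) := ⟨⟨0, hN⟩⟩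
  have : Nonempty (Fin q) := ⟨⟨0, hq⟩⟩
  have hp1 : (1 : ℝ) ≤ p := by exact_mod_cast (by omega : 1 ≤ p)
  have h := sketch_space_of_starSystem hε hδ0 hδ hE (fun e => (hEs e).trans hsr) L hL hb
    (s := geomLevels p K) hK (fun i => pow_pos (by omega) _)
    (fun i => by
      rw [Fintype.card_fin]
      exact mul_card_strictTail_geomLevels_le (16 * N) K i)
    (by simpa [sum_geomLevels] using hT)
    (by simpa [sum_geomLevels] using hm)
    -- `hU` makes even the largest level, of size `p ^ (K - 1)`, smaller than the number of petals
    -- by a factor `2 ^ (r / 16)` at each of the `N` centers.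
    (Q := ((2 : ℝ) ^ ((r : ℝ) / 16)) ^ N) (by positivity)
    (fun i => by
      simp only [Fintype.card_fin, Fintype.card_fun]
      rw [← mul_pow]
      refine pow_le_pow_left₀ (by positivity) (le_trans ?_ hU) N
      rw [geomLevels, Nat.cast_pow]
      exact mul_le_mul_of_nonneg_left (pow_le_pow_right₀ hp1 (Nat.sub_le _ _)) (by positivity))
  have h2 : (2 : ℝ) ^ ((r : ℝ) * N * K / 32) ≤ 2 ^ ((b : ℝ) + 2 + K) := by
    calc (2 : ℝ) ^ ((r : ℝ) * N * K / 32) =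
          (((2 : ℝ) ^ ((r : ℝ) / 16)) ^ N) ^ ((K : ℝ) / 2) := by
          rw [← Real.rpow_natCast, ← Real.rpow_mul (by positivity), ← Real.rpow_mul (by positivity)]
          congr 1
          ring
      _ ≤ (1 + ((2 : ℝ) ^ ((r : ℝ) / 16)) ^ N) ^ ((K : ℝ) / 2) :=
          Real.rpow_le_rpow (by positivity) (by linarith) (by positivity)
      _ ≤ 4 * (2 ^ b * 2 ^ K) := h
      _ = _ := by
          rw [Real.rpow_add (by norm_num), Real.rpow_add (by norm_num), Real.rpow_natCast,
            Real.rpow_natCast]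
          norm_num
          ring
  exact (Real.rpow_le_rpow_left_iff (by norm_num)).1 h2

/-- A number of levels proportional to `log (m / n) / log n` is possible. -/
theorem exists_levels {n m r s q : ℕ} (hn : 192 ≤ n) (hr : 2 ≤ r) (hrn : r ≤ n) (hnm : n ≤ m)
    (hm : m ≤ numHyperedges n r) (hsr : r ≤ 8 * s) (hq : 2 ≤ q) (hqn : n ≤ q * r) :
    ∃ K : ℕ, 0 < K ∧ Real.log ((m : ℝ) / n) / Real.log n / 512 ≤ K ∧
      16 * (n / 2 * ((∑ j ∈ Finset.range K, (16 * (n / 2) + 1) ^ j) *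
        (∑ j ∈ Finset.range K, (16 * (n / 2) + 1) ^ j - 1))) ≤ q ^ s ∧
      (∑ j ∈ Finset.range K, (16 * (n / 2) + 1) ^ j) * (n / 2) ≤ m ∧
      (2 : ℝ) ^ ((r : ℝ) / 16) * ((16 * (n / 2) + 1 : ℕ) : ℝ) ^ (K - 1) ≤ ((q ^ s : ℕ) : ℝ) := by
  have hn1 : (1 : ℝ) < n := by exact_mod_cast (by omega : 1 < n)
  have hn0 : (0 : ℝ) < n := by linarith
  set x : ℝ := (m : ℝ) / n
  have hx1 : 1 ≤ x := (one_le_div hn0).2 (by exact_mod_cast hnm)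
  have hx0 : 0 < x := by linarith
  have hlogn : 0 < Real.log n := Real.log_pos hn1
  set t : ℝ := Real.log x / Real.log n / 512
  have ht : 0 ≤ t := by have := Real.log_nonneg hx1; positivity
  have hxm : x ≤ m := div_le_self (by positivity) hn1.le
  have hU := petals_lower_bound hr hrn hm hsr hq hqn
  set N := n / 2
  have hpn : 16 * N + 1 ≤ n ^ 2 := by
    have : 16 * N + 1 ≤ 8 * n + 1 := by omega
    nlinarith
  have hnt : (n : ℝ) ^ t = x ^ ((1 : ℝ) / 512) := by
    rw [Real.rpow_def_of_pos hn0, Real.rpow_def_of_pos hx0]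
    congr 1
    simp only [t]
    field_simp
  set k := ⌊t⌋₊
  have hpk : ((16 * N + 1 : ℕ) : ℝ) ^ k ≤ x ^ ((1 : ℝ) / 256) := by
    calc ((16 * N + 1 : ℕ) : ℝ) ^ k ≤ ((n : ℝ) ^ 2) ^ k := by
          gcongr
          exact_mod_cast hpn
      _ = ((n : ℝ) ^ (k : ℝ)) ^ 2 := by rw [Real.rpow_natCast, ← pow_mul, ← pow_mul, mul_comm]
      _ ≤ ((n : ℝ) ^ t) ^ 2 := by
          gcongr
          · exact hn1.le
          · exact Nat.floor_le ht
      _ = x ^ ((1 : ℝ) / 256) := by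
          rw [hnt, ← Real.rpow_natCast, ← Real.rpow_mul hx0.le]
          norm_num
  have hUx : x ^ ((1 : ℝ) / 64) ≤ ((q ^ s : ℕ) : ℝ) := by
    refine le_trans (le_mul_of_one_le_left (by positivity) ?_) hU
    exact Real.one_le_rpow (by norm_num) (by positivity)
  have hU2 : (2 : ℝ) ^ ((r : ℝ) / 16) * ((16 * N + 1 : ℕ) : ℝ) ^ k ≤ ((q ^ s : ℕ) : ℝ) := by
    refine le_trans ?_ hU
    gcongr
    exact hpk.trans (Real.rpow_le_rpow_of_exponent_le hx1 (by norm_num))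
  refine ⟨k + 1, Nat.succ_pos k, ?_, ?_, ?_, hU2⟩
  · push_cast
    exact (Nat.lt_floor_add_one t).le
  all_goals
    -- For `k = 0` there is a single level with one sample per center, and `m / n` may be too small
    -- for the general estimate. For `k ≥ 1`, `k + 1 ≤ 2 * k` absorbs the extra level.
    obtain hk | hk := Nat.eq_zero_or_pos k
    · simp [hk]
      try omega
    have hpk2 : ((16 * N + 1 : ℕ) : ℝ) ^ (k + 1) ≤ x ^ ((1 : ℝ) / 128) := by
      calc ((16 * N + 1 : ℕ) : ℝ) ^ (k + 1) ≤ ((16 * N + 1 : ℕ) : ℝ) ^ (k * 2) := by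
            gcongr
            · exact_mod_cast (by omega : 1 ≤ 16 * N + 1)
            · omega
        _ = (((16 * N + 1 : ℕ) : ℝ) ^ k) ^ 2 := pow_mul _ _ _
        _ ≤ (x ^ ((1 : ℝ) / 256)) ^ 2 := by gcongr
        _ = _ := by
            rw [← Real.rpow_natCast, ← Real.rpow_mul hx0.le]
            norm_num
    have hgeom := geom_sum_mul_add (16 * N) (k + 1)
    set M := ∑ j ∈ Finset.range (k + 1), (16 * N + 1) ^ j
    set P := (16 * N + 1) ^ (k + 1)
  · have h1 : 16 * (N * (M * (M - 1))) ≤ P ^ 2 := by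
      have hMN : M ≤ M * (16 * N) := Nat.le_mul_of_pos_right _ (by omega)
      calc 16 * (N * (M * (M - 1))) = (M * (16 * N)) * (M - 1) := by ring
        _ ≤ P * P := Nat.mul_le_mul (by omega) (by omega)
        _ = P ^ 2 := (sq P).symm
    refine h1.trans ?_
    have h2 : ((P ^ 2 : ℕ) : ℝ) ≤ ((q ^ s : ℕ) : ℝ) := by
      refine le_trans ?_ hUx
      calc ((P ^ 2 : ℕ) : ℝ) = (((16 * N + 1 : ℕ) : ℝ) ^ (k + 1)) ^ 2 := by
            simp only [P]; push_cast; ring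
        _ ≤ (x ^ ((1 : ℝ) / 128)) ^ 2 := by gcongr
        _ = _ := by
            rw [← Real.rpow_natCast, ← Real.rpow_mul hx0.le]
            norm_num
    exact_mod_cast h2
  · have h1 : M * N ≤ P := by nlinarith
    refine h1.trans ?_
    have h2 : (P : ℝ) ≤ m := by
      calc (P : ℝ) = ((16 * N + 1 : ℕ) : ℝ) ^ (k + 1) := by simp only [P]; push_cast; ring
        _ ≤ x ^ ((1 : ℝ) / 128) := hpk2
        _ ≤ x ^ (1 : ℝ) := Real.rpow_le_rpow_of_exponent_le hx1 (by norm_num)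
        _ = x := Real.rpow_one x
        _ ≤ m := hxm
    exact_mod_cast h2

end HypergraphSketch

/-! ### The lower bound -/

theorem theorem2 (d : ℝ) (hd : 0 < d) :
    ∃ c : ℝ, 0 < c ∧ ∃ n₀ : ℕ, ∀ ε : ℝ, 0 < ε → ε < 1 →
      ∀ n m r b : ℕ, n₀ ≤ n → 2 ≤ r → r ≤ n → m ≤ HypergraphSketch.numHyperedges n r →
        ∀ L : HypergraphSketch.RandomizedLinearSketch.{u, v} n,
          L.RecoversSparsifier m r ε (1 / (n : ℝ) ^ d) → L.UsesBits m r b →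
            c * ((n : ℝ) * r * Real.log ((m : ℝ) / n) / Real.log n) ≤ b := by
  -- The factor 512 comes from the number of levels, and 192 = 3 * 64 from `n ≤ 3 * N` and the final
  -- bound `r * N * K / 64 ≤ b`. The second term of the maximum makes the failure probability at
  -- most 1/16.
  refine ⟨1 / (192 * 512), by norm_num, max 192 ⌈(16 : ℝ) ^ (1 / d)⌉₊, ?_⟩
  intro ε _ hε1 n m r b hn hr hrn hm L hL hb
  have hn192 : 192 ≤ n := (le_max_left _ _).trans hn
  have hn1 : (1 : ℝ) < n := by exact_mod_cast (by omega : 1 < n)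
  have hlogn : 0 < Real.log n := Real.log_pos hn1
  obtain hmn | hmn := lt_or_ge m n
  · have h1 : Real.log ((m : ℝ) / n) ≤ 0 := by
      refine Real.log_nonpos (by positivity) ((div_le_one (by linarith)).2 ?_)
      exact_mod_cast hmn.le
    have h2 : (n : ℝ) * r * Real.log ((m : ℝ) / n) / Real.log n ≤ 0 :=
      div_nonpos_of_nonpos_of_nonneg (mul_nonpos_of_nonneg_of_nonpos (by positivity) h1) hlogn.le
    exact (mul_nonpos_of_nonneg_of_nonpos (by norm_num) h2).trans (Nat.cast_nonneg b)
  have hδ : 1 / (n : ℝ) ^ d ≤ 1 / 16 := by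
    have h1 : (16 : ℝ) ^ (1 / d) ≤ n := Nat.ceil_le.1 ((le_max_right _ _).trans hn)
    have h2 : (16 : ℝ) ≤ (n : ℝ) ^ d := by
      calc (16 : ℝ) = ((16 : ℝ) ^ (1 / d)) ^ d := by
            rw [← Real.rpow_mul (by norm_num), one_div_mul_cancel hd.ne', Real.rpow_one]
        _ ≤ _ := by gcongr
    gcongr
  obtain ⟨s, q, hs, hsr, hrs, hq, hqn, hsq⟩ :=
    HypergraphSketch.petals_parameters (by omega : 16 ≤ n) hr hrn
  obtain ⟨K, hK, hKL, hT, hM, hU⟩ :=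
    HypergraphSketch.exists_levels hn192 hr hrn hmn hm hrs hq hqn
  have h := HypergraphSketch.sketch_space_of_levels (by omega) hε1 (by positivity) hδ L hL hb hs
    hsr (by omega) hsq hK hT hM hU
  set N := n / 2
  have hN : (n : ℝ) ≤ 3 * N := by exact_mod_cast (by omega : n ≤ 3 * N)
  have hK1 : (1 : ℝ) ≤ K := by exact_mod_cast hK
  -- This absorbs the loss: `2 + K ≤ 3 * K ≤ r * N * K / 64`, half of the main term.
  have hrN : (192 : ℝ) ≤ r * N := by
    exact_mod_cast (show 2 * 96 ≤ r * N from Nat.mul_le_mul hr (by omega))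
  have h3 : (192 : ℝ) * K ≤ r * N * K := by gcongr
  have h4 : (r : ℝ) * N * K / 64 ≤ b := by linarith
  have hlog : 0 ≤ Real.log ((m : ℝ) / n) :=
    Real.log_nonneg ((one_le_div (by linarith)).2 (by exact_mod_cast hmn))
  calc _ = (n : ℝ) * r / 192 * (Real.log ((m : ℝ) / n) / Real.log n / 512) := by ring
    _ ≤ (3 * N) * r / 192 * K := by gcongr
    _ = r * N * K / 64 := by ring
    _ ≤ b := h4
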